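/- Let $\mathcal Z=\mathbb R^n$, let $H:\mathcal Z\to\mathbb R$ be measurable and let $\rho(\mathrm dz)=e^{-H(z)}\,\mathrm dz$ be a probability measure. Let $\Phi:\mathcal Z\to\mathcal Z$ be a $C^1$-diffeomorphism, write $|\nabla\Phi(z)|$ for the absolute value of its Jacobian determinant, and let $\mu$ be a measure on a measurable space $\Omega$. For $\omega\in\Omega$ let $\alpha_\omega:\mathcal Z\to[0,1]$, with $\omega\mapsto\alpha_\omega(z)$ measurable for every $z$, and put $$\alpha(z)=\exp\Big\{\int\log\alpha_\omega(z)\,\mu(\mathrm d\omega)\Big\}\in[0,1],\qquad \exp(-\infty)=0.$$ A configuration $P$ is a countable sum of unit point masses on $\Omega$ (the space of configurations carries the $\sigma$-algebra generated by the counts $P\mapsto P(A)$, $A\subseteq\Omega$ measurable); $|P|$ is its number of points and $\mathcal P$ is the set of configurations with $|P|\ge 1$. For each $z$ let $\mathbb Q(\mathrm dP\mid z)$ be the law of the Poisson point process on $\Omega$ with intensity measure $-\log\alpha_\omega(z)\,\mu(\mathrm d\omega)$, depending measurably on $z$ (counts of measurable sets are Poisson with mean the intensity of the set, and counts of finitely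 many disjoint measurable sets are independent), and let $\mathbb Q_{|P|\ge1}(\mathrm dP\mid z)$ be this law conditioned on $|P|\ge1$. Let $Q_P(z,\mathrm dz')$ be Markov kernels on $\mathcal Z$, indexed by $P\in\mathcal P$ and jointly measurable in $(P,z)$. The doubly stochastic discrete-time PDMP is the Markov chain on $\mathcal Z$ with transition kernel $$K(z,\mathrm dz')=\alpha(z)\,\delta_{\Phi(z)}(\mathrm dz')+(1-\alpha(z))\,Q(z,\mathrm dz'),\qquad Q(z,\mathrm dz')=\int_{\mathcal P}\mathbb Q_{|P|\ge1}(\mathrm dP\mid z)\,Q_P(z,\mathrm dz'),$$ where the second term of $K$ is absent if $\alpha(z)=1$. Assume that there is a map $\mathcal S:\mathcal Z\to\mathcal Z$ such that: 1. $\mathcal S$ is measurable and preserves $\rho$, that is, $\rho(\mathcal S^{-1}(\mathrm dz))=\rho(\mathrm dz)$. 2. For all $z$, $$\int\big[\{-\log\alpha_\omega(\mathcal S\circ\Phi(z))\}-\{-\log\alpha_\omega(z)\}\big]\,\mu(\mathrm d\omega)=\log|\nabla\Phi(z)|-\{H(\Phi(z))-H(z)\},$$ where the integral is well defined: both logarithms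 are finite for $\mu$-almost all $\omega$ and their difference is $\mu$-integrable. 3. As an equality of measures on $\mathcal P\times\mathcal Z$, $$\int\rho(\mathrm dz)\,(1-\alpha(z))\,\mathbb Q_{|P|\ge1}(\mathrm dP\mid z)\,Q_P(z,\mathrm dz')=\rho(\mathcal S^{-1}(\mathrm dz'))\,(1-\alpha(\mathcal S(z')))\,\mathbb Q_{|P|\ge1}(\mathrm dP\mid\mathcal S(z')).$$ Then $K$ is a Markov transition kernel and $\rho$ is an invariant distribution of the discrete-time PDMP: $\int\rho(\mathrm dz)K(z,\mathrm dz')=\rho(\mathrm dz')$. -/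

import Mathlib

open MeasureTheory ProbabilityTheory
open scoped ENNReal NNReal Manifold

noncomputable section

namespace PDMP

section PointProcess

variable {Ω : Type*} [MeasurableSpace Ω]

/-- Point configurations on `Ω`: countable sums of unit point masses (finite or infinite, repeated
points allowed), identified with their counting measures. The σ-algebra is the usual one, generated
by the counts `P ↦ P A` of the points in measurable sets `A`. -/
abbrev Configuration (Ω : Type*) [MeasurableSpace Ω] : Type _ :=
  {P : Measure Ω // ∃ (ι : Type) (_ : Countable ι) (x : ι → Ω),
    P = Measure.sum fun i => Measure.dirac (x i)}

/-- The number `P(A)` of points of the configuration `P` in `A`, with values in `ℕ ∪ {∞}`. -/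
def count (P : Configuration Ω) (A : Set Ω) : ℝ≥0∞ := P.1 A

/-- The set of configurations having at least one point. -/
abbrev NonemptyConfiguration (Ω : Type*) [MeasurableSpace Ω] : Type _ :=
  {P : Configuration Ω // 1 ≤ count P Set.univ}

/-- The Poisson distribution with mean `r ∈ [0, ∞]`, on `ℕ ∪ {∞} ⊆ [0, ∞]`; it is the point mass
at `∞` if `r = ∞`. -/
def extendedPoisson (r : ℝ≥0∞) : Measure ℝ≥0∞ :=
  if r = ∞ then Measure.dirac ∞
  else (poissonMeasure r.toNNReal).map (fun k : ℕ => (k : ℝ≥0∞))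

/-- `L` is the law of a Poisson point process on `Ω` with intensity measure `Λ`: the number of
points in a measurable set `A` is Poisson with mean `Λ A`, and the numbers of points in finitely
many pairwise disjoint measurable sets are independent. -/
structure IsPoissonProcessLaw (L : Measure (Configuration Ω)) (Λ : Measure Ω) : Prop where
  isProbabilityMeasure : IsProbabilityMeasure L
  map_count : ∀ A : Set Ω, MeasurableSet A →
    L.map (fun P => count P A) = extendedPoisson (Λ A)
  iIndepFun_count : ∀ (m : ℕ) (A : Fin m → Set Ω), (∀ i, MeasurableSet (A i)) →
    Pairwise (Function.onFun Disjoint A) → iIndepFun (fun i P => count P (A i)) L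

/-- The conditional law of the point process given that it has at least one point, as a measure on
the set of configurations with at least one point. (It is the zero measure if that event is null.) -/
def condNonempty (L : Measure (Configuration Ω)) : Measure (NonemptyConfiguration Ω) :=
  (ProbabilityTheory.cond L {P | 1 ≤ count P Set.univ}).comap Subtype.val

end PointProcess

section Acceptance

variable {Ω Z : Type*} [MeasurableSpace Ω]

/-- `-log a ∈ [0, ∞]` for `a ∈ [0, 1]`, with `-log 0 = ∞`. -/
def negLog (a : ℝ) : ℝ≥0∞ := if a = 0 then ∞ else ENNReal.ofReal (-Real.log a)

/-- The rate `Λ_z(dω) = -log α_ω(z) μ(dω)` of the Poisson process at the state `z`. -/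
def intensity (μ : Measure Ω) (α : Ω → Z → ℝ) (z : Z) : Measure Ω :=
  μ.withDensity fun ω => negLog (α ω z)

/-- The acceptance probability `α(z) = exp (∫ log α_ω(z) μ(dω))`; the integral of the nonpositive
function is taken in `[-∞, 0]`, and `exp (-∞) = 0`. -/
def acceptance (μ : Measure Ω) (α : Ω → Z → ℝ) (z : Z) : ℝ≥0∞ :=
  EReal.exp (-((∫⁻ ω, negLog (α ω z) ∂μ : ℝ≥0∞) : EReal))

end Acceptance

section Transition

/-- The one-step transition of a discrete-time PDMP,
`K(z, dz') = a(z) δ_{Φ(z)}(dz') + (1 - a(z)) Q(z, dz')`. -/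
def transition {Z : Type*} [MeasurableSpace Z] (a : Z → ℝ≥0∞) (Φ : Z → Z) (Q : Z → Measure Z)
    (z : Z) : Measure Z :=
  a z • Measure.dirac (Φ z) + (1 - a z) • Q z

/-- The event kernel `Q(z, dz') = ∫ ℚ(dP | z, |P| ≥ 1) Q_P(z, dz')`, where `L z` is the law
`ℚ(dP | z)` and `QP (P, z)` is `Q_P(z, ·)`. -/
def eventKernel {Ω Z : Type*} [MeasurableSpace Ω] [MeasurableSpace Z]
    (L : Z → Measure (Configuration Ω)) (QP : NonemptyConfiguration Ω × Z → Measure Z) (z : Z) :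
    Measure Z :=
  (condNonempty (L z)).bind fun P => QP (P, z)

/-- The measure `ρ(dz) = exp (-H(z)) dz` on `ℝⁿ`. -/
def target {n : ℕ} (H : EuclideanSpace ℝ (Fin n) → ℝ) : Measure (EuclideanSpace ℝ (Fin n)) :=
  volume.withDensity fun z => ENNReal.ofReal (Real.exp (-H z))

/-- The integrated balance condition: for all `z`,
`∫ [-log α_ω(S(Φ z)) - (-log α_ω(z))] μ(dω) = log |∇Φ(z)| - (H(Φ z) - H(z))`,
where the integral is well defined: the logarithms are finite for almost all `ω` and their
difference is integrable. -/
def BalanceCondition {Ω : Type*} [MeasurableSpace Ω] {n : ℕ} (μ : Measure Ω)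
    (α : Ω → EuclideanSpace ℝ (Fin n) → ℝ) (H : EuclideanSpace ℝ (Fin n) → ℝ)
    (Φ S : EuclideanSpace ℝ (Fin n) → EuclideanSpace ℝ (Fin n)) : Prop :=
  ∀ z, (∀ᵐ ω ∂μ, 0 < α ω z ∧ 0 < α ω (S (Φ z))) ∧
    Integrable (fun ω => (-Real.log (α ω (S (Φ z)))) - (-Real.log (α ω z))) μ ∧
    ∫ ω, ((-Real.log (α ω (S (Φ z)))) - (-Real.log (α ω z))) ∂μ =
      Real.log |(fderiv ℝ Φ z).det| - (H (Φ z) - H z)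

/-- The skewed invariance of the kernels `Q_P`,
`∫ ρ(dz) (1 - a(z)) ℚ(dP | z, |P| ≥ 1) Q_P(z, dz')
  = ρ(S⁻¹(dz')) (1 - a(S z')) ℚ(dP | S z', |P| ≥ 1)`,
as an equality of measures in `(P, dz')`, tested on all measurable rectangles. -/
def SkewedInvariance {Ω Z : Type*} [MeasurableSpace Ω] [MeasurableSpace Z] (ρ : Measure Z)
    (a : Z → ℝ≥0∞) (S : Z → Z) (L : Z → Measure (Configuration Ω))
    (QP : NonemptyConfiguration Ω × Z → Measure Z) : Prop :=
  ∀ (A : Set (NonemptyConfiguration Ω)) (B : Set Z), MeasurableSet A → MeasurableSet B →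
    ∫⁻ z, (1 - a z) * ∫⁻ P in A, QP (P, z) B ∂(condNonempty (L z)) ∂ρ =
      ∫⁻ z' in B, (1 - a (S z')) * condNonempty (L (S z')) A ∂(ρ.map S)

end Transition

end PDMP

end

namespace PDMP

/-! ### Void probabilities and conditioning on at least one point. -/

section PointProcess

variable {Ω : Type*} [MeasurableSpace Ω]

/-! The mass that one step carries into a set `B` splits into accepted moves and events.
Exponentiating the balance condition gives `e^{-H(z)} α(z) = |∇Φ(z)| e^{-H(Φ z)} α(S(Φ z))`, so the
substitution `w = Φ z` turns the accepted mass into `∫_B α(S w) ρ(dw)`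
(`BalanceCondition.lintegral_acceptance_mul_indicator`). Skewed invariance, summed over all
configurations and combined with the invariance of `ρ` under `S`, turns the event mass into `∫_B (1
- α(S w)) ρ(dw)`. The two add up to `ρ(B)`.

That the transition is a Markov kernel rests on the Poisson void probability: `1 - α(z)` is exactly
the probability of at least one point (`one_sub_acceptance_eq`), hence the constant that normalizes
the conditional law. -/

theorem measurable_count {A : Set Ω} (hA : MeasurableSet A) :
    Measurable fun P : Configuration Ω => count P A :=
  (Measure.measurable_coe hA).comp measurable_subtype_coe

theorem measurableSet_one_le_count :
    MeasurableSet {P : Configuration Ω | 1 ≤ count P Set.univ} :=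
  measurableSet_le measurable_const (measurable_count MeasurableSet.univ)

theorem measurableEmbedding_nonemptyConfiguration :
    MeasurableEmbedding (Subtype.val : NonemptyConfiguration Ω → Configuration Ω) :=
  MeasurableEmbedding.subtype_coe measurableSet_one_le_count

/-- A count below one is zero, so this is the void probability; for `r = ∞` both sides vanish. -/
theorem extendedPoisson_lt_one (r : ℝ≥0∞) :
    extendedPoisson r {x | x < 1} = EReal.exp (-(r : EReal)) := by
  have hm : MeasurableSet {x : ℝ≥0∞ | x < 1} := measurableSet_Iio
  induction r with
  | top => simp [extendedPoisson]
  | coe r =>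
    have hpre : (fun k : ℕ => (k : ℝ≥0∞)) ⁻¹' {x | x < 1} = {0} := by
      ext k
      simp
    rw [extendedPoisson, if_neg ENNReal.coe_ne_top, Measure.map_apply .of_discrete hm, hpre,
      poissonMeasure_singleton, ENNReal.toNNReal_coe]
    change _ = EReal.exp (-((r : ℝ) : EReal))
    rw [← EReal.coe_neg, EReal.exp_coe]
    simp

theorem IsPoissonProcessLaw.measure_one_le_count {L : Measure (Configuration Ω)} {Λ : Measure Ω}
    (hL : IsPoissonProcessLaw L Λ) :
    L {P | 1 ≤ count P Set.univ} = 1 - EReal.exp (-(Λ Set.univ : EReal)) := by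
  have := hL.isProbabilityMeasure
  have hcompl : {P : Configuration Ω | 1 ≤ count P Set.univ}
      = ((fun P => count P Set.univ) ⁻¹' {x | x < 1})ᶜ := by
    ext P
    simp
  have hm : MeasurableSet {x : ℝ≥0∞ | x < 1} := measurableSet_Iio
  rw [hcompl, prob_compl_eq_one_sub (measurable_count MeasurableSet.univ hm),
    ← Measure.map_apply (measurable_count MeasurableSet.univ) hm,
    hL.map_count _ MeasurableSet.univ, extendedPoisson_lt_one]

/-- The weight cancels the normalization of the conditional law. A null event needs no separate
case, since both sides are then zero. -/
theorem smul_condNonempty (L : Measure (Configuration Ω)) [IsFiniteMeasure L] :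
    L {P | 1 ≤ count P Set.univ} • condNonempty L = L.comap Subtype.val := by
  have he := measurableEmbedding_nonemptyConfiguration (Ω := Ω)
  ext t ht
  rw [Measure.smul_apply, condNonempty, he.comap_apply, he.comap_apply, smul_eq_mul, mul_comm,
    cond_mul_eq_inter measurableSet_one_le_count]
  congr 1
  refine Set.inter_eq_right.2 ?_
  rintro _ ⟨P, -, rfl⟩
  exact P.2

theorem measure_mul_condNonempty_univ (L : Measure (Configuration Ω)) [IsFiniteMeasure L] :
    L {P | 1 ≤ count P Set.univ} * condNonempty L Set.univ = L {P | 1 ≤ count P Set.univ} := by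
  rw [← smul_eq_mul, ← Measure.smul_apply, smul_condNonempty,
    measurableEmbedding_nonemptyConfiguration.comap_apply]
  simp

end PointProcess

/-! ### The acceptance probability. -/

section Acceptance

variable {Ω Z : Type*} [MeasurableSpace Ω] {μ : Measure Ω} {α : Ω → Z → ℝ}

theorem intensity_univ (z : Z) : intensity μ α z Set.univ = ∫⁻ ω, negLog (α ω z) ∂μ := by
  rw [intensity, withDensity_apply _ MeasurableSet.univ, Measure.restrict_univ]

theorem acceptance_le_one (z : Z) : acceptance μ α z ≤ 1 := by
  rw [acceptance, EReal.exp_le_one_iff, EReal.neg_le, neg_zero]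
  exact EReal.coe_ennreal_nonneg _

theorem one_sub_acceptance_eq {L : Z → Measure (Configuration Ω)}
    (hL : ∀ z, IsPoissonProcessLaw (L z) (intensity μ α z)) (z : Z) :
    1 - acceptance μ α z = L z {P | 1 ≤ count P Set.univ} := by
  rw [(hL z).measure_one_le_count, intensity_univ, acceptance]

theorem one_sub_acceptance_mul_condNonempty_univ {L : Z → Measure (Configuration Ω)}
    (hL : ∀ z, IsPoissonProcessLaw (L z) (intensity μ α z)) (z : Z) :
    (1 - acceptance μ α z) * condNonempty (L z) Set.univ = 1 - acceptance μ α z := by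
  have := (hL z).isProbabilityMeasure
  rw [one_sub_acceptance_eq hL, measure_mul_condNonempty_univ]

/-- Joint measurability of `α` in `(ω, z)` is not available; measurability in `z` comes from the
kernel `L` through the void probability. -/
theorem measurable_acceptance [MeasurableSpace Z] {L : Kernel Z (Configuration Ω)}
    (hL : ∀ z, IsPoissonProcessLaw (L z) (intensity μ α z)) : Measurable (acceptance μ α) := by
  have h : acceptance μ α = fun z => 1 - L z {P | 1 ≤ count P Set.univ} := by
    ext z
    rw [← one_sub_acceptance_eq hL z,
      ENNReal.sub_sub_cancel ENNReal.one_ne_top (acceptance_le_one z)]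
  rw [h]
  exact measurable_const.sub (L.measurable_coe measurableSet_one_le_count)

theorem negLog_ae_eq {z : Z} (h : ∀ᵐ ω ∂μ, 0 < α ω z) :
    (fun ω => negLog (α ω z)) =ᵐ[μ] fun ω => ENNReal.ofReal (-Real.log (α ω z)) := by
  filter_upwards [h] with ω hω
  rw [negLog, if_neg hω.ne']

theorem acceptance_eq_ofReal_exp (hα : ∀ ω z, α ω z ∈ Set.Icc (0 : ℝ) 1) {z : Z}
    (hz : ∀ᵐ ω ∂μ, 0 < α ω z) (hi : Integrable (fun ω => -Real.log (α ω z)) μ) :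
    acceptance μ α z = ENNReal.ofReal (Real.exp (-∫ ω, -Real.log (α ω z) ∂μ)) := by
  have h0 : ∀ ω, 0 ≤ -Real.log (α ω z) := fun ω =>
    neg_nonneg.2 (Real.log_nonpos (hα ω z).1 (hα ω z).2)
  rw [acceptance, lintegral_congr_ae (negLog_ae_eq hz),
    ← ofReal_integral_eq_lintegral_ofReal hi (Filter.Eventually.of_forall h0),
    EReal.coe_ennreal_ofReal, max_eq_left (integral_nonneg h0), ← EReal.coe_neg, EReal.exp_coe]

theorem acceptance_eq_zero (hα : ∀ ω z, α ω z ∈ Set.Icc (0 : ℝ) 1)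
    (hαm : ∀ z, Measurable fun ω => α ω z) {z : Z}
    (hz : ∀ᵐ ω ∂μ, 0 < α ω z) (hi : ¬ Integrable (fun ω => -Real.log (α ω z)) μ) :
    acceptance μ α z = 0 := by
  have h0 : ∀ ω, 0 ≤ -Real.log (α ω z) := fun ω =>
    neg_nonneg.2 (Real.log_nonpos (hα ω z).1 (hα ω z).2)
  have htop : ∫⁻ ω, ENNReal.ofReal (-Real.log (α ω z)) ∂μ = ∞ := by
    by_contra hne
    exact hi ((lintegral_ofReal_ne_top_iff_integrable
      ((hαm z).log.neg.aestronglyMeasurable) (Filter.Eventually.of_forall h0)).1 hne)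
  rw [acceptance, lintegral_congr_ae (negLog_ae_eq hz), htop]
  simp

/-- The acceptance probabilities at two points are in the ratio given by the integrated difference
of the rates, both being zero if either of the rates is not integrable. -/
theorem acceptance_eq_mul_acceptance (hα : ∀ ω z, α ω z ∈ Set.Icc (0 : ℝ) 1)
    (hαm : ∀ z, Measurable fun ω => α ω z) {z w : Z}
    (hzw : ∀ᵐ ω ∂μ, 0 < α ω z ∧ 0 < α ω w)
    (hi : Integrable (fun ω => (-Real.log (α ω w)) - (-Real.log (α ω z))) μ) :
    acceptance μ α z = ENNReal.ofReal
      (Real.exp (∫ ω, ((-Real.log (α ω w)) - (-Real.log (α ω z))) ∂μ)) * acceptance μ α w := by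
  have hz : ∀ᵐ ω ∂μ, 0 < α ω z := hzw.mono fun _ h => h.1
  have hw : ∀ᵐ ω ∂μ, 0 < α ω w := hzw.mono fun _ h => h.2
  by_cases hiz : Integrable (fun ω => -Real.log (α ω z)) μ
  · have hiw : Integrable (fun ω => -Real.log (α ω w)) μ := 
      (hi.add hiz).congr (Filter.Eventually.of_forall fun ω => sub_add_cancel _ _)
    rw [acceptance_eq_ofReal_exp hα hz hiz, acceptance_eq_ofReal_exp hα hw hiw,
      integral_sub hiw hiz, ← ENNReal.ofReal_mul (Real.exp_pos _).le, ← Real.exp_add]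
    congr 2
    ring
  -- The difference of the rates is integrable, so the two rates fail to be integrable together.
  · have hiw : ¬ Integrable (fun ω => -Real.log (α ω w)) μ := fun hiw =>
      
      hiz ((hiw.sub hi).congr (Filter.Eventually.of_forall fun ω => sub_sub_cancel _ _))
    rw [acceptance_eq_zero hα hαm hz hiz, acceptance_eq_zero hα hαm hw hiw, mul_zero]

end Acceptance

/-! ### Change of variables and the transition kernel. -/

section Transition

theorem det_fderiv_ne_zero {E : Type*} [NormedAddCommGroup E] [NormedSpace ℝ E]
    (Φ : E ≃ₘ^1⟮𝓘(ℝ, E), 𝓘(ℝ, E)⟯ E) (z : E) : (fderiv ℝ Φ z).det ≠ 0 := by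
  have h1 : DifferentiableAt ℝ Φ z := Φ.contDiff.differentiable one_ne_zero z
  have h2 : DifferentiableAt ℝ Φ.symm (Φ z) := Φ.symm.contDiff.differentiable one_ne_zero _
  have hcomp := fderiv_comp z h2 h1
  have hid : (Φ.symm ∘ Φ : E → E) = id := funext Φ.symm_apply_apply
  rw [hid, fderiv_id] at hcomp
  intro h0
  have hdet := congrArg (fun f : E →L[ℝ] E => f.det) hcomp
  simp only [ContinuousLinearMap.det] at hdet h0
  rw [ContinuousLinearMap.toLinearMap_comp, LinearMap.det_comp, h0, mul_zero,
    ContinuousLinearMap.coe_id, LinearMap.det_id] at hdet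
  exact one_ne_zero hdet

theorem lintegral_abs_det_fderiv_mul_comp {E : Type*} [NormedAddCommGroup E] [NormedSpace ℝ E]
    [FiniteDimensional ℝ E] [MeasurableSpace E] [BorelSpace E] (ν : Measure E)
    [ν.IsAddHaarMeasure] (Φ : E ≃ₘ^1⟮𝓘(ℝ, E), 𝓘(ℝ, E)⟯ E) (g : E → ℝ≥0∞) :
    ∫⁻ z, ENNReal.ofReal |(fderiv ℝ Φ z).det| * g (Φ z) ∂ν = ∫⁻ w, g w ∂ν := by
  have h := lintegral_image_eq_lintegral_abs_det_fderiv_mul ν MeasurableSet.univ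
    (fun z _ => ((Φ.contDiff.differentiable one_ne_zero z).hasFDerivAt).hasFDerivWithinAt)
    Φ.injective.injOn g
  rw [Set.image_univ, (show Function.Surjective Φ from Φ.surjective).range_eq, Measure.restrict_univ] at h
  exact h.symm

variable {Ω : Type*} [MeasurableSpace Ω] {Z : Type*} [MeasurableSpace Z]

theorem lintegral_target {n : ℕ} {H : EuclideanSpace ℝ (Fin n) → ℝ} (hH : Measurable H)
    {f : EuclideanSpace ℝ (Fin n) → ℝ≥0∞} (hf : Measurable f) :
    ∫⁻ z, f z ∂target H = ∫⁻ z, ENNReal.ofReal (Real.exp (-H z)) * f z := by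
  rw [target, lintegral_withDensity_eq_lintegral_mul _ (by fun_prop) hf]
  rfl

theorem eventKernel_apply (L : Z → Measure (Configuration Ω))
    (QP : Kernel (NonemptyConfiguration Ω × Z) Z) (z : Z) {B : Set Z} (hB : MeasurableSet B) :
    eventKernel L QP z B = ∫⁻ P, QP (P, z) B ∂condNonempty (L z) :=
  Measure.bind_apply hB (QP.measurable.comp measurable_prodMk_right).aemeasurable

theorem transition_apply (a : Z → ℝ≥0∞) (Φ : Z → Z) (Q : Z → Measure Z) (z : Z) {B : Set Z}
    (hB : MeasurableSet B) :
    transition a Φ Q z B = a z * B.indicator 1 (Φ z) + (1 - a z) * Q z B := by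
  simp [transition, Measure.dirac_apply' _ hB]

variable {μ : Measure Ω} {α : Ω → Z → ℝ}

/-- The weight removes the conditioning, leaving an integral against the restriction of `L z` to
nonempty configurations, which is a kernel in `z`. -/
theorem measurable_one_sub_acceptance_mul_eventKernel {L : Kernel Z (Configuration Ω)}
    (hL : ∀ z, IsPoissonProcessLaw (L z) (intensity μ α z))
    (QP : Kernel (NonemptyConfiguration Ω × Z) Z) [IsSFiniteKernel QP] {B : Set Z}
    (hB : MeasurableSet B) :
    Measurable fun z => (1 - acceptance μ α z) * eventKernel L QP z B := by
  have : IsMarkovKernel L := ⟨fun z => (hL z).isProbabilityMeasure⟩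
  let L' : Kernel Z (NonemptyConfiguration Ω) :=
    L.comapRight measurableEmbedding_nonemptyConfiguration
  have h : (fun z => (1 - acceptance μ α z) * eventKernel L QP z B)
      = fun z => ∫⁻ P, QP (P, z) B ∂L' z := by
    ext z
    rw [one_sub_acceptance_eq hL, eventKernel_apply _ _ _ hB, ← smul_eq_mul,
      ← lintegral_smul_measure, smul_condNonempty]
    rfl
  rw [h]
  exact Measurable.lintegral_kernel_prod_right
    ((QP.measurable_coe hB).comp measurable_swap)

theorem measurable_transition {L : Kernel Z (Configuration Ω)}
    (hL : ∀ z, IsPoissonProcessLaw (L z) (intensity μ α z))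
    (QP : Kernel (NonemptyConfiguration Ω × Z) Z) [IsSFiniteKernel QP] {Φ : Z → Z}
    (hΦ : Measurable Φ) :
    Measurable (transition (acceptance μ α) Φ (eventKernel L QP)) := by
  refine Measure.measurable_of_measurable_coe _ fun B hB => ?_
  simp only [transition_apply _ _ _ _ hB]
  exact ((measurable_acceptance hL).mul ((measurable_one.indicator hB).comp hΦ)).add
    (measurable_one_sub_acceptance_mul_eventKernel hL QP hB)

theorem isProbabilityMeasure_transition {L : Z → Measure (Configuration Ω)}
    (hL : ∀ z, IsPoissonProcessLaw (L z) (intensity μ α z))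
    (QP : Kernel (NonemptyConfiguration Ω × Z) Z) [IsMarkovKernel QP] (Φ : Z → Z) (z : Z) :
    IsProbabilityMeasure (transition (acceptance μ α) Φ (eventKernel L QP) z) := by
  refine ⟨?_⟩
  rw [transition_apply _ _ _ _ MeasurableSet.univ, eventKernel_apply _ _ _ MeasurableSet.univ]
  simp only [measure_univ, lintegral_one, one_sub_acceptance_mul_condNonempty_univ hL]
  simp [add_tsub_cancel_of_le (acceptance_le_one z)]

end Transition

/-! ### The mass carried by accepted moves. -/

section Balance

variable {Ω : Type*} [MeasurableSpace Ω] {n : ℕ} {μ : Measure Ω}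
  {α : Ω → EuclideanSpace ℝ (Fin n) → ℝ} {H : EuclideanSpace ℝ (Fin n) → ℝ}
  {S : EuclideanSpace ℝ (Fin n) → EuclideanSpace ℝ (Fin n)}

theorem BalanceCondition.density_mul_acceptance
    {Φ : EuclideanSpace ℝ (Fin n)
      ≃ₘ^1⟮𝓘(ℝ, EuclideanSpace ℝ (Fin n)), 𝓘(ℝ, EuclideanSpace ℝ (Fin n))⟯
      EuclideanSpace ℝ (Fin n)}
    (h : BalanceCondition μ α H Φ S) (hα : ∀ ω z, α ω z ∈ Set.Icc (0 : ℝ) 1)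
    (hαm : ∀ z, Measurable fun ω => α ω z) (z : EuclideanSpace ℝ (Fin n)) :
    ENNReal.ofReal (Real.exp (-H z)) * acceptance μ α z =
      ENNReal.ofReal |(fderiv ℝ Φ z).det| *
        (ENNReal.ofReal (Real.exp (-H (Φ z))) * acceptance μ α (S (Φ z))) := by
  obtain ⟨hpos, hi, heq⟩ := h z
  have hdet : 0 < |(fderiv ℝ Φ z).det| := abs_pos.2 (det_fderiv_ne_zero Φ z)
  rw [acceptance_eq_mul_acceptance hα hαm hpos hi, heq, ← mul_assoc, ← mul_assoc,
    ← ENNReal.ofReal_mul (Real.exp_pos _).le, ← ENNReal.ofReal_mul hdet.le]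
  congr 2
  -- The first occurrence of the Jacobian sits inside the logarithm; the second is the factor to be
  -- written as an exponential.
  nth_rewrite 2 [← Real.exp_log hdet]
  rw [← Real.exp_add, ← Real.exp_add]
  congr 1
  ring

/-- Under the balance condition, the accepted moves carry the mass `∫_B a(S w) ρ(dw)` into `B`. -/
theorem BalanceCondition.lintegral_acceptance_mul_indicator
    {Φ : EuclideanSpace ℝ (Fin n)
      ≃ₘ^1⟮𝓘(ℝ, EuclideanSpace ℝ (Fin n)), 𝓘(ℝ, EuclideanSpace ℝ (Fin n))⟯
      EuclideanSpace ℝ (Fin n)}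
    (h : BalanceCondition μ α H Φ S) (hα : ∀ ω z, α ω z ∈ Set.Icc (0 : ℝ) 1)
    (hαm : ∀ z, Measurable fun ω => α ω z) (hH : Measurable H) (hS : Measurable S)
    (ha : Measurable (acceptance μ α)) {B : Set (EuclideanSpace ℝ (Fin n))}
    (hB : MeasurableSet B) :
    ∫⁻ z, acceptance μ α z * B.indicator 1 (Φ z) ∂target H =
      ∫⁻ w in B, acceptance μ α (S w) ∂target H := by
  have hind : Measurable (B.indicator (1 : EuclideanSpace ℝ (Fin n) → ℝ≥0∞)) :=
    measurable_one.indicator hB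
  have hm : Measurable fun z => acceptance μ α z * B.indicator 1 (Φ z) :=
    ha.mul (hind.comp Φ.contDiff.continuous.measurable)
  have haS : Measurable fun w => acceptance μ α (S w) := ha.comp hS
  have hmul : ∀ w, B.indicator (fun w => acceptance μ α (S w)) w
      = acceptance μ α (S w) * B.indicator 1 w := fun w => by
    by_cases hw : w ∈ B <;> simp [hw]
  rw [← lintegral_indicator hB, lintegral_target hH (haS.indicator hB),
    -- The left integral is still against `target H`, so the substitution `w = Φ z` acts on the
    -- right side only.
    ← lintegral_abs_det_fderiv_mul_comp volume Φ,
    lintegral_target hH hm]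
  refine lintegral_congr fun z => ?_
  rw [hmul, ← mul_assoc, h.density_mul_acceptance hα hαm z]
  ring

end Balance

end PDMP

theorem mainTheorem5 {n : ℕ} {Ω : Type*} [MeasurableSpace Ω] (μ : Measure Ω)
    (H : EuclideanSpace ℝ (Fin n) → ℝ) (hH : Measurable H)
    (hρ : IsProbabilityMeasure (PDMP.target H))
    (Φ : EuclideanSpace ℝ (Fin n)
      ≃ₘ^1⟮𝓘(ℝ, EuclideanSpace ℝ (Fin n)), 𝓘(ℝ, EuclideanSpace ℝ (Fin n))⟯
      EuclideanSpace ℝ (Fin n))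
    (α : Ω → EuclideanSpace ℝ (Fin n) → ℝ)
    (hα : ∀ ω z, α ω z ∈ Set.Icc (0 : ℝ) 1)
    (hαm : ∀ z, Measurable fun ω => α ω z)
    (L : Kernel (EuclideanSpace ℝ (Fin n)) (PDMP.Configuration Ω))
    (hL : ∀ z, PDMP.IsPoissonProcessLaw (L z) (PDMP.intensity μ α z))
    (QP : Kernel (PDMP.NonemptyConfiguration Ω × EuclideanSpace ℝ (Fin n))
      (EuclideanSpace ℝ (Fin n)))
    (hQP : IsMarkovKernel QP)
    (S : EuclideanSpace ℝ (Fin n) → EuclideanSpace ℝ (Fin n))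
    (hS : MeasurePreserving S (PDMP.target H) (PDMP.target H))
    (hbalance : PDMP.BalanceCondition μ α H Φ S)
    (hskew : PDMP.SkewedInvariance (PDMP.target H) (PDMP.acceptance μ α) S L QP) :
    ∃ K : Kernel (EuclideanSpace ℝ (Fin n)) (EuclideanSpace ℝ (Fin n)),
      IsMarkovKernel K ∧
      (∀ z, K z = PDMP.transition (PDMP.acceptance μ α) Φ (PDMP.eventKernel L QP) z) ∧
      K.Invariant (PDMP.target H) := by
  have ha := PDMP.measurable_acceptance hL
  have hΦ : Measurable Φ := Φ.contDiff.continuous.measurable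
  let K : Kernel (EuclideanSpace ℝ (Fin n)) (EuclideanSpace ℝ (Fin n)) :=
    ⟨PDMP.transition (PDMP.acceptance μ α) Φ (PDMP.eventKernel L QP),
      PDMP.measurable_transition hL QP hΦ⟩
  refine ⟨K, ⟨fun z => PDMP.isProbabilityMeasure_transition hL QP Φ z⟩, fun z => rfl, ?_⟩
  ext B hB
  have hevent : ∫⁻ z, (1 - PDMP.acceptance μ α z) * PDMP.eventKernel L QP z B ∂PDMP.target H =
      ∫⁻ w in B, (1 - PDMP.acceptance μ α (S w)) ∂PDMP.target H := by
    -- Only the marginal in `z'` is needed, so the configuration is left free.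
    have h := hskew Set.univ B MeasurableSet.univ hB
    simp only [PDMP.one_sub_acceptance_mul_condNonempty_univ hL, hS.map_eq,
      Measure.restrict_univ] at h
    simpa only [PDMP.eventKernel_apply _ _ _ hB] using h
  calc (PDMP.target H).bind K B
      = ∫⁻ z, (PDMP.acceptance μ α z * B.indicator 1 (Φ z) +
          (1 - PDMP.acceptance μ α z) * PDMP.eventKernel L QP z B) ∂PDMP.target H := by
        rw [Measure.bind_apply hB K.aemeasurable]
        exact lintegral_congr fun z => PDMP.transition_apply _ _ _ _ hB
    _ = ∫⁻ w in B, (PDMP.acceptance μ α (S w) + (1 - PDMP.acceptance μ α (S w)))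
          ∂PDMP.target H := by
        rw [lintegral_add_left (by exact ha.mul ((measurable_one.indicator hB).comp hΦ)), hevent,
          hbalance.lintegral_acceptance_mul_indicator hα hαm hH hS.measurable ha hB,
          lintegral_add_left (by exact ha.comp hS.measurable)]
    _ = PDMP.target H B := by
        simp only [add_tsub_cancel_of_le (PDMP.acceptance_le_one _), lintegral_one,
          Measure.restrict_apply_univ]
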